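/- **Theorem.** A (deterministic) algorithm $A$ learns an unknown function $f:[0,1]\to\mathbb{R}$ online: on trial $t=0,1,2,\dots$ it receives $x_t\in[0,1]$, outputs a prediction $\hat y_t\in\mathbb{R}$ that depends only on $x_t$ and on the earlier pairs $(x_0,f(x_0)),\dots,(x_{t-1},f(x_{t-1}))$, and is then told $f(x_t)$. For $p\ge 1$, a function $f$, and $x=(x_0,\dots,x_m)\in[0,1]^{m+1}$, let $$L_p(A,f,x)=\sum_{t=1}^m|\hat y_t-f(x_t)|^p$$ (the first trial $t=0$ is not counted). For a class $\mathcal{F}$ of functions $[0,1]\to\mathbb{R}$ let $$\mathrm{opt}_p(\mathcal{F})=\inf_A\ \sup\Big\{L_p(A,f,x): f\in\mathcal{F},\ m\in\mathbb{N},\ x\in[0,1]^{m+1}\Big\}\in[0,\infty].$$ For real $q\ge1$ let $\mathcal{F}_q$ be the class of absolutely continuous $f:[0,1]\to\mathbb{R}$ with $\int_0^1|f'(x)|^q\,dx\le1$, and let $\mathcal{F}_\infty$ be the class of absolutely continuous $f:[0,1]\to\mathbb{R}$ with $|f'(x)|\le1$ for almost every $x\in[0,1]$. Then there are absolute constants $c,C>0$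 such that for every $\varepsilon\in(0,1)$ $$c\,\varepsilon^{-1/2}\le\mathrm{opt}_{1+\varepsilon}(\mathcal{F}_\infty)\le C\,\varepsilon^{-1/2},$$ and, for every real $q\ge2$, $$c\,\varepsilon^{-1/2}\le\mathrm{opt}_{1+\varepsilon}(\mathcal{F}_q)\le C\,\varepsilon^{-1/2}.$$ -/

import Mathlib

open scoped ENNReal
open MeasureTheory

noncomputable section

namespace OnlineLearning

/-- A (deterministic) prediction algorithm: from the list of the earlier inputs together with the
revealed true values (in chronological order) and the current input in `[0, 1]`, it outputs a
real prediction. -/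
abbrev Algorithm : Type := List (unitInterval × ℝ) → unitInterval → ℝ

/-- The prediction `ŷ_t = A ((x_0, f x_0), …, (x_{t-1}, f x_{t-1})) x_t` of `A` on trial `t`,
when the target function is `f` and the inputs are `x = (x_0, …, x_m)`. -/
def prediction (A : Algorithm) (f : unitInterval → ℝ) {m : ℕ} (x : Fin (m + 1) → unitInterval)
    (t : Fin (m + 1)) : ℝ :=
  A (List.ofFn fun s : Fin (t : ℕ) =>
    (x ⟨s, s.isLt.trans t.isLt⟩, f (x ⟨s, s.isLt.trans t.isLt⟩))) (x t)

/-- `L_p(A, f, x) = ∑_{t = 1}^m |ŷ_t - f(x_t)|^p`; the trial `t = 0` does not count. -/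
def loss (p : ℝ) (A : Algorithm) (f : unitInterval → ℝ) {m : ℕ}
    (x : Fin (m + 1) → unitInterval) : ℝ :=
  ∑ t : Fin m, |prediction A f x t.succ - f (x t.succ)| ^ p

/-- `L_p(A, F)`: the supremum in `[0, ∞]` of `L_p(A, f, x)` over all targets `f ∈ F` and all finite
input sequences `x ∈ [0, 1]^{m+1}`, `m ∈ ℕ`. -/
def worstLoss (p : ℝ) (A : Algorithm) (F : Set (unitInterval → ℝ)) : ℝ≥0∞ :=
  ⨆ f ∈ F, ⨆ (m : ℕ) (x : Fin (m + 1) → unitInterval), ENNReal.ofReal (loss p A f x)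

/-- `opt_p(F) = inf_A L_p(A, F)`, as an element of `[0, ∞]`. -/
def opt (p : ℝ) (F : Set (unitInterval → ℝ)) : ℝ≥0∞ :=
  ⨅ A : Algorithm, worstLoss p A F

/-- The class `F_q`, `1 ≤ q ≤ ∞`, of the absolutely continuous `f : [0, 1] → ℝ` with
`‖f'‖_q ≤ 1`, the norm being that of `L^q([0, 1])`. The derivative is that of the extension of `f`
to `ℝ` by constants, which on `(0, 1)` is the derivative of `f`. -/
def smoothClass (q : ℝ≥0∞) : Set (unitInterval → ℝ) :=
  {f | AbsolutelyContinuousOnInterval (Set.IccExtend (zero_le_one' ℝ) f) 0 1 ∧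
    eLpNorm (deriv (Set.IccExtend (zero_le_one' ℝ) f)) q
      (volume.restrict (Set.Icc (0 : ℝ) 1)) ≤ 1}

end OnlineLearning

end

noncomputable section

namespace OnlineLearning

/-! On a probability space the classes shrink as `q` grows, so it is enough to bound `opt` below on
`smoothClass ⊤` and above on `smoothClass 2`.

Lower bound (`exists_adversary`): bisect the known intervals, placing each midpoint value `η * w`
off the chord, on the side away from the prediction. Slopes then perform a walk with steps `±2η`, so
about `1/ε` levels are affordable when `η` is of order `√ε`. At these widths the extra exponent `ε`
costs only a constant, so a level earns order `η`, and all levels together order `ε^(-1/2)`.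

Upper bound (`isGapPotential_chordPotential`): predict by linear interpolation. An error `δ` in a
gap split into widths `a`, `b` raises the chord energy by at least `δ² / min a b`. Weighted AM-GM
bounds `|δ|^(1+ε)` by `ε^(-1/2)` times this gain plus `ε^(1/2) * (min a b)^s`, where `s =
(1+ε)/(1-ε)`; the last term is paid by the drop in the sum of the `s`-th powers of the gap widths.
Energy and width terms each contribute at most `ε^(-1/2)` in total. -/

/-! ### Losses along lists of examples -/

/-- The loss of `A` on the examples `d`, presented in order after the history `h`. -/
def lossAlong (p : ℝ) (A : Algorithm) :
    List (unitInterval × ℝ) → List (unitInterval × ℝ) → ℝ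
  | _, [] => 0
  | h, e :: d => |A h e.1 - e.2| ^ p + lossAlong p A (h ++ [e]) d

theorem lossAlong_append (p : ℝ) (A : Algorithm) (h d d' : List (unitInterval × ℝ)) :
    lossAlong p A h (d ++ d') = lossAlong p A h d + lossAlong p A (h ++ d) d' := by
  induction d generalizing h with
  | nil => simp [lossAlong]
  | cons e d ih => simp [lossAlong, ih, add_assoc]

theorem loss_eq_lossAlong (p : ℝ) (A : Algorithm) (f : unitInterval → ℝ) {m : ℕ}
    (x : Fin (m + 1) → unitInterval) :
    loss p A f x = lossAlong p A [(x 0, f (x 0))]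
      (List.ofFn fun t : Fin m => (x t.succ, f (x t.succ))) := by
  induction m with
  | zero => simp [loss, lossAlong]
  | succ m ih =>
    have h := ih fun i => x i.castSucc
    rw [List.ofFn_succ', List.concat_eq_append, lossAlong_append, loss, Fin.sum_univ_castSucc]
    refine congrArg₂ (· + ·) h ?_
    simp only [lossAlong, add_zero, prediction]
    congr 4
    simp [List.ofFn_succ]
    rfl

theorem loss_get_eq_lossAlong (p : ℝ) (A : Algorithm) (f : unitInterval → ℝ)
    (e : unitInterval × ℝ) (d : List (unitInterval × ℝ)) (hf : ∀ r ∈ e :: d, f r.1 = r.2) :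
    loss p A f (fun i : Fin (d.length + 1) => ((e :: d).get i).1) = lossAlong p A [e] d := by
  rw [loss_eq_lossAlong]
  have h0 : ∀ r ∈ e :: d, (r.1, f r.1) = r := fun r hr => Prod.ext rfl (hf r hr)
  congr 1
  · simp [h0 e]
  · conv_rhs => rw [← List.ofFn_get d]
    congr 1
    funext t
    exact h0 _ (by simp)

theorem lossAlong_le_worstLoss (p : ℝ) (A : Algorithm) {F : Set (unitInterval → ℝ)}
    {f : unitInterval → ℝ} (hfF : f ∈ F) (e : unitInterval × ℝ) (d : List (unitInterval × ℝ))
    (hf : ∀ r ∈ e :: d, f r.1 = r.2) :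
    ENNReal.ofReal (lossAlong p A [e] d) ≤ worstLoss p A F := by
  rw [← loss_get_eq_lossAlong p A f e d hf]
  exact le_iSup₂_of_le f hfF (le_iSup₂_of_le (f := fun (m : ℕ) (x : Fin (m + 1) → unitInterval) =>
    ENNReal.ofReal (loss p A f x)) _ _ le_rfl)

theorem opt_mono (p : ℝ) {F G : Set (unitInterval → ℝ)} (h : F ⊆ G) : opt p F ≤ opt p G :=
  iInf_mono fun _ => biSup_mono h

/-! ### The smoothness classes -/

instance isProbabilityMeasure_restrict_Icc :
    IsProbabilityMeasure (volume.restrict (Set.Icc (0 : ℝ) 1)) :=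
  ⟨by simp⟩

theorem smoothClass_anti {q r : ℝ≥0∞} (h : q ≤ r) : smoothClass r ⊆ smoothClass q :=
  fun _ hf => ⟨hf.1, (eLpNorm_le_eLpNorm_of_exponent_le h
    (measurable_deriv _).aestronglyMeasurable).trans hf.2⟩

theorem mem_smoothClass_top_of_lipschitzWith {f : unitInterval → ℝ} (hf : LipschitzWith 1 f) :
    f ∈ smoothClass ⊤ := by
  have h : LipschitzWith 1 (Set.IccExtend (zero_le_one' ℝ) f) := by
    have := hf.comp (LipschitzWith.projIcc (zero_le_one' ℝ))
    rwa [one_mul] at this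
  refine ⟨(h.lipschitzOnWith).absolutelyContinuousOnInterval, ?_⟩
  rw [eLpNorm_exponent_top]
  refine eLpNormEssSup_le_of_ae_bound (C := 1) (.of_forall fun x => ?_) |>.trans (by simp)
  simpa using norm_deriv_le_of_lipschitz (x₀ := x) h

end OnlineLearning

namespace OnlineLearning

/-! ### The lower bound -/

/-- The forward light cone: `r` lies to the right of `e` and the slope from `e` to `r` is at most
`1` in absolute value. -/
def Cone (e r : unitInterval × ℝ) : Prop := |r.2 - e.2| ≤ r.1 - e.1

theorem Cone.refl (e : unitInterval × ℝ) : Cone e e := by simp [Cone]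

theorem Cone.trans {e r s : unitInterval × ℝ} (h : Cone e r) (h' : Cone r s) : Cone e s := by
  unfold Cone at *
  have := abs_add_le (s.2 - r.2) (r.2 - e.2)
  rw [sub_add_sub_cancel] at this
  linarith

theorem Cone.abs_sub_le {e r : unitInterval × ℝ} (h : Cone e r ∨ Cone r e) :
    |e.2 - r.2| ≤ |(e.1 : ℝ) - r.1| := by
  rcases h with h | h
  · rw [abs_sub_comm, abs_sub_comm (e.1 : ℝ)]
    exact le_trans h (le_abs_self _)
  · exact le_trans h (le_abs_self _)

/-- Data whose slopes are bounded by `1` are interpolated by a `1`-Lipschitz function. -/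
theorem exists_lipschitzWith_of_cone (l : List (unitInterval × ℝ))
    (hl : ∀ e ∈ l, ∀ r ∈ l, Cone e r ∨ Cone r e) :
    ∃ f : unitInterval → ℝ, LipschitzWith 1 f ∧ ∀ e ∈ l, f e.1 = e.2 := by
  classical
  -- The choice is harmless: the cone condition forces equal values at equal inputs.
  let g : unitInterval → ℝ := fun x => if h : ∃ y, (x, y) ∈ l then h.choose else 0
  have hg : ∀ e ∈ l, g e.1 = e.2 := by
    intro e he
    have h : ∃ y, (e.1, y) ∈ l := ⟨e.2, he⟩
    have h1 := Cone.abs_sub_le (hl _ h.choose_spec _ he)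
    simp only [sub_self, abs_zero, abs_nonpos_iff, sub_eq_zero] at h1
    simpa only [g, dif_pos h] using h1
  have hLip : LipschitzOnWith 1 g {x | ∃ y, (x, y) ∈ l} := by
    rintro x ⟨y, hx⟩ x' ⟨y', hx'⟩
    rw [edist_dist, edist_dist, ENNReal.coe_one, one_mul, hg _ hx, hg _ hx']
    refine ENNReal.ofReal_le_ofReal ?_
    exact Cone.abs_sub_le (hl _ hx _ hx')
  obtain ⟨f, hf, hfg⟩ := hLip.extend_real
  exact ⟨f, hf, fun e he => (hfg ⟨e.2, he⟩).symm.trans (hg e he)⟩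

/-- Against any algorithm, starting from an interval of length `w` over which the data have slope
`σ`, an adversary presents examples inside the interval, keeping all slopes in `[-1, 1]` and
changing them by `±2η` with each bisection. -/
theorem exists_adversary (A : Algorithm) {p η ρ κ : ℝ} (hη : 0 < η) (hη' : η ≤ 1 / 4)
    (hρ : 0 ≤ ρ) (hκ : ∀ w : ℝ, κ ≤ w → w ≤ 1 → ρ * w ≤ (η * w) ^ p) (hκ0 : 0 < κ)
    (hp : 0 ≤ p) (n : ℕ) :
    ∀ (h : List (unitInterval × ℝ)) (P Q : unitInterval × ℝ) (w σ : ℝ), (Q.1 : ℝ) = P.1 + w →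
      Q.2 = P.2 + σ * w → κ * 2 ^ n ≤ w → |σ| ≤ 1 →
      ∃ d : List (unitInterval × ℝ), (∀ e ∈ d, Cone P e ∧ Cone e Q) ∧
        (∀ e ∈ d, ∀ r ∈ d, Cone e r ∨ Cone r e) ∧
        w * ρ * n * (1 - 4 * σ ^ 2 - 8 * η ^ 2 * n) ≤ lossAlong p A h d := by
  induction n with
  | zero => intro h P Q w σ _ _ _ _; exact ⟨[], by simp, by simp, by simp [lossAlong]⟩
  | succ n ih =>
    intro h P Q w σ hx hy hw hσ
    have hw0 : 0 < w := lt_of_lt_of_le (by positivity) hw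
    -- For steep chords the claimed bound is nonpositive, so the adversary stops; otherwise `2η ≤
    -- 1/2` leaves room for one more step.
    rcases lt_or_ge (1 / 2) |σ| with hσ2 | hσ2
    · refine ⟨[], by simp, by simp, ?_⟩
      rw [lossAlong]
      refine mul_nonpos_of_nonneg_of_nonpos (by positivity) ?_
      have h1 : (1 / 2) ^ 2 ≤ |σ| ^ 2 := pow_le_pow_left₀ (by norm_num) hσ2.le 2
      rw [sq_abs] at h1
      have : 0 ≤ 8 * η ^ 2 * ((n + 1 : ℕ) : ℝ) := by positivity
      linarith
    have hP := P.1.2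
    have hQ := Q.1.2
    rw [hx] at hQ
    let x : unitInterval := ⟨P.1 + w / 2, by linarith [hP.1], by linarith [hQ.2]⟩
    obtain ⟨s, hs, hloss⟩ : ∃ s : ℝ, |s| = 1 ∧
        η * w ≤ |A h x - (P.2 + σ * w / 2 + s * (η * w))| := by
      rcases le_total (A h x) (P.2 + σ * w / 2) with hA | hA
      · refine ⟨1, by simp, ?_⟩
        rw [abs_sub_comm]
        exact le_trans (by linarith) (le_abs_self _)
      · exact ⟨-1, by simp, le_trans (by linarith) (le_abs_self _)⟩
    have hss : s ^ 2 = 1 := by rw [← sq_abs, hs, one_pow]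
    let M : unitInterval × ℝ := (x, P.2 + σ * w / 2 + s * (η * w))
    have hslope : ∀ τ : ℝ, |τ| = 1 → |σ + τ * (2 * η)| ≤ 1 := by
      intro τ hτ
      have := abs_add_le σ (τ * (2 * η))
      rw [abs_mul, hτ, one_mul, abs_of_pos (by positivity : 0 < 2 * η)] at this
      linarith
    have h1 := hslope s hs
    have h2 := hslope (-s) (by rwa [abs_neg])
    have hPM : Cone P M := by
      have : M.2 - P.2 = (σ + s * (2 * η)) * (w / 2) := by simp only [M]; ring
      rw [Cone, this, abs_mul, abs_of_pos (half_pos hw0)]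
      have : ((M.1 : ℝ)) - P.1 = w / 2 := by simp [M, x]
      rw [this]
      nlinarith
    have hMQ : Cone M Q := by
      have : Q.2 - M.2 = (σ + -s * (2 * η)) * (w / 2) := by simp only [M, hy]; ring
      rw [Cone, this, abs_mul, abs_of_pos (half_pos hw0)]
      have : (Q.1 : ℝ) - M.1 = w / 2 := by simp only [M, x, hx]; ring
      rw [this]
      nlinarith
    have hw2 : κ * 2 ^ n ≤ w / 2 := by rw [pow_succ] at hw; linarith
    obtain ⟨d, hd, hdd, hdl⟩ := ih (h ++ [M]) P M (w / 2) (σ + s * (2 * η)) (by simp [M, x])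
      (by simp only [M]; ring) hw2 h1
    obtain ⟨d', hd', hdd', hdl'⟩ := ih (h ++ [M] ++ d) M Q (w / 2) (σ + -s * (2 * η))
      (by simp only [M, x, hx]; ring) (by simp only [M, hy]; ring) hw2 h2
    refine ⟨M :: (d ++ d'), ?_, ?_, ?_⟩
    · simp only [List.mem_cons, List.mem_append]
      rintro e (rfl | he | he)
      · exact ⟨hPM, hMQ⟩
      · exact ⟨(hd e he).1, (hd e he).2.trans hMQ⟩
      · exact ⟨hPM.trans (hd' e he).1, (hd' e he).2⟩
    · simp only [List.mem_cons, List.mem_append]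
      rintro e (rfl | he | he) r (rfl | hr | hr)
      · exact .inl (.refl _)
      · exact .inr (hd r hr).2
      · exact .inl (hd' r hr).1
      · exact .inl (hd e he).2
      · exact hdd e he r hr
      · exact .inl ((hd e he).2.trans (hd' r hr).1)
      · exact .inr (hd' e he).1
      · exact .inr ((hd r hr).2.trans (hd' e he).1)
      · exact hdd' e he r hr
    · rw [lossAlong, lossAlong_append]
      have hκw : κ ≤ w := by
        have : (1 : ℝ) ≤ 2 ^ (n + 1) := one_le_pow₀ (by norm_num)
        nlinarith
      have hstep : ρ * w ≤ |A h M.1 - M.2| ^ p :=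
        (hκ w hκw (by linarith [hP.1, hQ.2])).trans
          (Real.rpow_le_rpow (by positivity) hloss hp)
      -- Averaging over the two halves cancels the cross terms in `σ`, so the mean squared slope
      -- grows by exactly `4η²`.
      have hsum : w / 2 * ρ * n * (1 - 4 * (σ + s * (2 * η)) ^ 2 - 8 * η ^ 2 * n) +
          w / 2 * ρ * n * (1 - 4 * (σ + -s * (2 * η)) ^ 2 - 8 * η ^ 2 * n) =
          w * ρ * n * (1 - 4 * σ ^ 2 - 16 * η ^ 2 - 8 * η ^ 2 * n) := by
        linear_combination (-16 * w * ρ * n * η ^ 2) * hss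
      have hgap : 0 ≤ w * ρ * (4 * σ ^ 2 + 8 * η ^ 2) := by positivity
      push_cast
      nlinarith

/-- With `K` bisection levels and `η = 1/(4√K)`, the factor `1 - 8η²K` is `1/2`, and `K * η/64 * 1/2
= √K/512`. -/
theorem lower_bound_lipschitz {ε : ℝ} (hε : 0 < ε) (hε1 : ε < 1) :
    ENNReal.ofReal (1 / 512 * ε ^ (-(1 / 2) : ℝ)) ≤ opt (1 + ε) (smoothClass ⊤) := by
  refine le_iInf fun A => ?_
  obtain ⟨K, hK1, hK2⟩ : ∃ K : ℕ, 1 / ε ≤ K ∧ (K : ℝ) * ε ≤ 2 := by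
    refine ⟨⌈1 / ε⌉₊, Nat.le_ceil _, ?_⟩
    have := Nat.ceil_lt_add_one (by positivity : 0 ≤ 1 / ε)
    calc _ ≤ (1 / ε + 1) * ε := by gcongr
      _ = 1 + ε := by field_simp
      _ ≤ 2 := by linarith
  have hKpos : (1 : ℝ) ≤ K := le_trans (by rw [le_div_iff₀ hε]; linarith) hK1
  have hs1 : 1 ≤ √(K : ℝ) := Real.one_le_sqrt.2 hKpos
  have hsq : √(K : ℝ) ^ 2 = K := Real.sq_sqrt (by linarith)
  set s := √(K : ℝ)
  have hs0 : 0 < s := by linarith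
  set η : ℝ := 1 / (4 * s) with hη
  have hη0 : 0 < η := by positivity
  have hη4 : η ≤ 1 / 4 := by
    rw [hη]; exact one_div_le_one_div_of_le (by norm_num) (by linarith)
  have hκ : ∀ w : ℝ, (1 / 2 : ℝ) ^ K ≤ w → w ≤ 1 → η / 64 * w ≤ (η * w) ^ (1 + ε) := by
    intro w hw _
    have hw0 : 0 < w := lt_of_lt_of_le (by positivity) hw
    have h2K : (K : ℝ) ≤ 2 ^ K := by exact_mod_cast Nat.lt_two_pow_self.le
    have hsK : s ≤ 2 ^ K := by nlinarith
    -- Since `K * ε ≤ 2`, the exponent `(2K+2)ε` is at most `6`, whence the constant `1/64`.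
    have hb : (1 / 2 : ℝ) ^ (2 * K + 2) ≤ η * w := by
      have : (1 / 2 : ℝ) ^ (2 * K + 2) = 1 / (4 * 2 ^ K) * (1 / 2) ^ K := by
        rw [pow_add, two_mul, pow_add, one_div_pow 2 K]; ring
      rw [this, hη]
      gcongr
    have hε' : (1 / 64 : ℝ) ≤ (η * w) ^ ε := by
      calc (1 / 64 : ℝ) = (1 / 2 : ℝ) ^ (6 : ℝ) := by norm_num
        _ ≤ (1 / 2 : ℝ) ^ (((2 * K + 2 : ℕ) : ℝ) * ε) := by
          refine Real.rpow_le_rpow_of_exponent_ge (by norm_num) (by norm_num) ?_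
          push_cast; nlinarith
        _ = ((1 / 2 : ℝ) ^ (2 * K + 2)) ^ ε := by
          rw [Real.rpow_mul (by norm_num), Real.rpow_natCast]
        _ ≤ _ := Real.rpow_le_rpow (by positivity) hb hε.le
    rw [Real.rpow_add (by positivity), Real.rpow_one]
    calc η / 64 * w = η * w * (1 / 64) := by ring
      _ ≤ _ := by gcongr
  let P : unitInterval × ℝ := (0, 0)
  let Q : unitInterval × ℝ := (1, 0)
  have hPQ : Cone P Q := by simp [Cone, P, Q]
  obtain ⟨d, hd, hdd, hdl⟩ := exists_adversary A (p := 1 + ε) (ρ := η / 64) hη0 hη4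
    (by positivity) hκ (by positivity) (by linarith) K [P, Q] P Q 1 0 (by simp [P, Q])
    (by simp [P, Q]) (by rw [← mul_pow]; norm_num) (by simp)
  obtain ⟨f, hf, hfd⟩ := exists_lipschitzWith_of_cone (P :: Q :: d) (by
    simp only [List.mem_cons]
    rintro e (rfl | rfl | he) r (rfl | rfl | hr)
    · exact .inl (.refl _)
    · exact .inl hPQ
    · exact .inl (hd r hr).1
    · exact .inr hPQ
    · exact .inl (.refl _)
    · exact .inr (hd r hr).2
    · exact .inr (hd e he).1
    · exact .inl (hd e he).2
    · exact hdd e he r hr)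
  refine le_trans (ENNReal.ofReal_le_ofReal ?_)
    (lossAlong_le_worstLoss (1 + ε) A (mem_smoothClass_top_of_lipschitzWith hf) P (Q :: d) hfd)
  -- `P` is the uncounted trial; the loss at `Q` is counted but discarded.
  have h0 : 0 ≤ |A [P] Q.1 - Q.2| ^ (1 + ε) := Real.rpow_nonneg (abs_nonneg _) _
  rw [lossAlong]
  refine le_trans ?_ (le_add_of_nonneg_of_le h0 hdl)
  have hval : 1 * (η / 64) * K * (1 - 4 * (0 : ℝ) ^ 2 - 8 * η ^ 2 * K) = 1 / 512 * s := by
    rw [hη, ← hsq]; field_simp; norm_num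
  rw [hval]
  have : ε ^ (-(1 / 2) : ℝ) ≤ s := by
    rw [Real.rpow_neg hε.le, ← Real.sqrt_eq_rpow, ← Real.sqrt_inv, ← one_div]
    exact Real.sqrt_le_sqrt hK1
  linarith

end OnlineLearning

namespace OnlineLearning

/-! ### The upper bound: linear interpolation -/

/-- Insertion of an example into a list of examples sorted by their inputs. -/
def insertExample (e : unitInterval × ℝ) : List (unitInterval × ℝ) → List (unitInterval × ℝ)
  | [] => [e]
  | r :: l => if e.1 ≤ r.1 then e :: r :: l else r :: insertExample e l

/-- The examples of a history, sorted by their inputs. -/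
def sortExamples (h : List (unitInterval × ℝ)) : List (unitInterval × ℝ) :=
  h.foldl (fun l e => insertExample e l) []

/-- The value at `x` of the piecewise linear interpolant of the sorted examples `r :: l`, for `x` to
the right of `r`. -/
def interpolateFrom (r : unitInterval × ℝ) : List (unitInterval × ℝ) → unitInterval → ℝ
  | [], _ => r.2
  | r' :: l, x =>
    if x ≤ r'.1 then r.2 + (r'.2 - r.2) * (((x : ℝ) - r.1) / (r'.1 - r.1))
    else interpolateFrom r' l x

/-- The value at `x` of the piecewise linear interpolant of a list of sorted examples, extended by
constants. -/
def interpolate : List (unitInterval × ℝ) → unitInterval → ℝ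
  | [], _ => 0
  | r :: l, x => if x ≤ r.1 then r.2 else interpolateFrom r l x

/-- The algorithm that predicts by linear interpolation. -/
def linearInterpolation : Algorithm := fun h x => interpolate (sortExamples h) x

/-- The sum of `φ` over the consecutive inputs of `r :: l`. -/
def gapSumFrom (φ : unitInterval → unitInterval → ℝ) (r : unitInterval × ℝ) :
    List (unitInterval × ℝ) → ℝ
  | [] => 0
  | r' :: l => φ r.1 r'.1 + gapSumFrom φ r' l

/-- The sum of `φ` over the consecutive inputs of a list of examples. -/
def gapSum (φ : unitInterval → unitInterval → ℝ) : List (unitInterval × ℝ) → ℝ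
  | [] => 0
  | r :: l => gapSumFrom φ r l

theorem mem_insertExample {e r : unitInterval × ℝ} {l : List (unitInterval × ℝ)} :
    r ∈ insertExample e l ↔ r = e ∨ r ∈ l := by
  induction l with
  | nil => simp [insertExample]
  | cons a l ih =>
    rw [insertExample]
    split_ifs <;> simp [ih]
    tauto

theorem sorted_insertExample (e : unitInterval × ℝ) {l : List (unitInterval × ℝ)}
    (hl : l.Pairwise fun a b => a.1 ≤ b.1) :
    (insertExample e l).Pairwise fun a b => a.1 ≤ b.1 := by
  induction l with
  | nil => simp [insertExample]
  | cons a l ih =>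
    rw [List.pairwise_cons] at hl
    rw [insertExample]
    split_ifs with h
    · refine List.pairwise_cons.2 ⟨fun r hr => ?_, List.pairwise_cons.2 hl⟩
      rcases List.mem_cons.1 hr with rfl | hr
      · exact h
      · exact h.trans (hl.1 r hr)
    · refine List.pairwise_cons.2 ⟨fun r hr => ?_, ih hl.2⟩
      rcases mem_insertExample.1 hr with rfl | hr
      · exact (not_le.1 h).le
      · exact hl.1 r hr

theorem sortExamples_concat (h : List (unitInterval × ℝ)) (e : unitInterval × ℝ) :
    sortExamples (h ++ [e]) = insertExample e (sortExamples h) := by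
  simp [sortExamples]

theorem mem_sortExamples {r : unitInterval × ℝ} {h : List (unitInterval × ℝ)} :
    r ∈ sortExamples h ↔ r ∈ h := by
  induction h using List.reverseRecOn with
  | nil => simp [sortExamples]
  | append_singleton h e ih => simp [sortExamples_concat, mem_insertExample, ih, or_comm]

theorem sorted_sortExamples (h : List (unitInterval × ℝ)) :
    (sortExamples h).Pairwise fun a b => a.1 ≤ b.1 := by
  induction h using List.reverseRecOn with
  | nil => simp [sortExamples]
  | append_singleton h e ih => rw [sortExamples_concat]; exact sorted_insertExample e ih

/-- `φ` is a potential for the loss with exponent `p` of linear interpolation on the target `f`: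
its sum over the gaps between the known inputs grows by at least the loss in every trial. -/
structure IsGapPotential (p : ℝ) (f : unitInterval → ℝ) (φ : unitInterval → unitInterval → ℝ) :
    Prop where
  inner : ∀ u x v : unitInterval, u < x → x ≤ v →
    |f u + (f v - f u) * (((x : ℝ) - u) / (v - u)) - f x| ^ p + φ u v ≤ φ u x + φ x v
  right : ∀ u x : unitInterval, u ≤ x → |f u - f x| ^ p ≤ φ u x
  left : ∀ x v : unitInterval, x ≤ v → |f v - f x| ^ p ≤ φ x v

/-! ### Amortized loss of linear interpolation -/

namespace IsGapPotential

variable {p : ℝ} {f : unitInterval → ℝ} {φ : unitInterval → unitInterval → ℝ}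

theorem gapSumFrom_insertExample (hφ : IsGapPotential p f φ) (x : unitInterval)
    (l : List (unitInterval × ℝ)) (r : unitInterval × ℝ) (hl : ∀ e ∈ r :: l, f e.1 = e.2)
    (hx : r.1 < x) :
    |interpolateFrom r l x - f x| ^ p + gapSumFrom φ r l ≤
      gapSumFrom φ r (insertExample (x, f x) l) := by
  induction l generalizing r with
  | nil =>
    have := hφ.right r.1 x hx.le
    rw [hl r (by simp)] at this
    simpa [insertExample, gapSumFrom, interpolateFrom] using this
  | cons a l ih =>
    rw [insertExample, interpolateFrom]
    split_ifs with h
    · have := hφ.inner r.1 x a.1 hx h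
      rw [hl r (by simp), hl a (by simp)] at this
      simp only [gapSumFrom]
      linarith
    · have := ih a (fun e he => hl e (List.mem_cons_of_mem _ he)) (not_le.1 h)
      simp only [gapSumFrom]
      linarith

theorem gapSum_insertExample (hφ : IsGapPotential p f φ) (x : unitInterval)
    (l : List (unitInterval × ℝ)) (hne : l ≠ []) (hl : ∀ e ∈ l, f e.1 = e.2) :
    |interpolate l x - f x| ^ p + gapSum φ l ≤ gapSum φ (insertExample (x, f x) l) := by
  cases l with
  | nil => exact absurd rfl hne
  | cons r l =>
    rw [insertExample, interpolate]
    split_ifs with h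
    · have := hφ.left x r.1 h
      rw [hl r (by simp)] at this
      simp only [gapSum, gapSumFrom]
      linarith
    · exact hφ.gapSumFrom_insertExample x l r hl (not_le.1 h)

theorem lossAlong_add_gapSum_le (hφ : IsGapPotential p f φ) (d h : List (unitInterval × ℝ))
    (hne : h ≠ []) (hh : ∀ e ∈ h ++ d, f e.1 = e.2) :
    lossAlong p linearInterpolation h d + gapSum φ (sortExamples h) ≤
      gapSum φ (sortExamples (h ++ d)) := by
  induction d generalizing h with
  | nil => simp [lossAlong]
  | cons e d ih =>
    have h1 := ih (h ++ [e]) (by simp) (by simpa using hh)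
    obtain ⟨r, hr⟩ := List.exists_mem_of_ne_nil h hne
    have h2 := hφ.gapSum_insertExample e.1 (sortExamples h)
      (List.ne_nil_of_mem (mem_sortExamples.2 hr))
      fun e he => hh e (List.mem_append_left _ (mem_sortExamples.1 he))
    rw [hh e (by simp)] at h2
    rw [sortExamples_concat, List.append_assoc, List.singleton_append] at h1
    rw [lossAlong, linearInterpolation]
    simp only [Prod.mk.eta] at h2
    linarith

end IsGapPotential

/-- The bounds telescope; monotonicity of `H` covers the stretch beyond the last input. -/
theorem gapSumFrom_le {φ : unitInterval → unitInterval → ℝ} {H : unitInterval → ℝ}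
    (hH : Monotone H) (hφ : ∀ u v, u ≤ v → φ u v ≤ H v - H u) (l : List (unitInterval × ℝ))
    (r : unitInterval × ℝ) (hl : (r :: l).Pairwise fun a b => a.1 ≤ b.1) :
    gapSumFrom φ r l ≤ H 1 - H r.1 := by
  induction l generalizing r with
  | nil => simpa [gapSumFrom] using hH unitInterval.le_one'
  | cons a l ih =>
    rw [List.pairwise_cons] at hl
    have h1 := ih a hl.2
    have h2 := hφ r.1 a.1 (hl.1 a (by simp))
    rw [gapSumFrom]
    linarith

theorem gapSum_le {φ : unitInterval → unitInterval → ℝ} {H : unitInterval → ℝ}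
    (hH : Monotone H) (hφ : ∀ u v, u ≤ v → φ u v ≤ H v - H u) (l : List (unitInterval × ℝ))
    (hl : l.Pairwise fun a b => a.1 ≤ b.1) : gapSum φ l ≤ H 1 - H 0 := by
  cases l with
  | nil => simpa [gapSum] using hH unitInterval.le_one'
  | cons r l =>
    have h1 := gapSumFrom_le hH hφ l r hl
    have h2 : H 0 ≤ H r.1 := hH unitInterval.nonneg'
    rw [gapSum]
    linarith

theorem IsGapPotential.worstLoss_le {p : ℝ} {F : Set (unitInterval → ℝ)} {B : ℝ}
    (hF : ∀ f ∈ F, ∃ (φ : unitInterval → unitInterval → ℝ) (H : unitInterval → ℝ),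
      IsGapPotential p f φ ∧ Monotone H ∧ (∀ u v, u ≤ v → φ u v ≤ H v - H u) ∧ H 1 - H 0 ≤ B) :
    worstLoss p linearInterpolation F ≤ ENNReal.ofReal B := by
  refine iSup₂_le fun f hf => iSup₂_le fun m x => ENNReal.ofReal_le_ofReal ?_
  obtain ⟨φ, H, hφ, hH, hφH, hB⟩ := hF f hf
  rw [loss_eq_lossAlong]
  have h1 := hφ.lossAlong_add_gapSum_le
    (List.ofFn fun t : Fin m => (x t.succ, f (x t.succ))) [(x 0, f (x 0))] (by simp) (by
      simp only [List.mem_append, List.mem_singleton, List.mem_ofFn]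
      rintro e (rfl | ⟨t, rfl⟩) <;> rfl)
  have h2 := gapSum_le hH hφH _ (sorted_sortExamples ([(x 0, f (x 0))] ++
    List.ofFn fun t : Fin m => (x t.succ, f (x t.succ))))
  have h3 : gapSum φ (sortExamples [(x 0, f (x 0))]) = 0 := by
    simp [sortExamples, insertExample, gapSum, gapSumFrom]
  linarith

/-! ### The energy of a function in `F_2` -/

theorem sq_integral_le_mul_integral_sq {g : ℝ → ℝ} {a b : ℝ} (hab : a ≤ b)
    (hg : IntervalIntegrable g volume a b)
    (hg2 : IntervalIntegrable (fun x => g x ^ 2) volume a b) :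
    (∫ x in a..b, g x) ^ 2 ≤ (b - a) * ∫ x in a..b, g x ^ 2 := by
  rcases hab.eq_or_lt with rfl | hlt
  · simp
  have hba : 0 < b - a := sub_pos.2 hlt
  set I := ∫ x in a..b, g x
  have h0 : 0 ≤ ∫ x in a..b, (g x - I / (b - a)) ^ 2 :=
    intervalIntegral.integral_nonneg hab fun x _ => sq_nonneg _
  have h1 : ∫ x in a..b, (g x - I / (b - a)) ^ 2 =
      (∫ x in a..b, g x ^ 2) - 2 * (I / (b - a)) * I + (b - a) * (I / (b - a)) ^ 2 := by
    have : ∀ x, (g x - I / (b - a)) ^ 2 =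
        g x ^ 2 - 2 * (I / (b - a)) * g x + (I / (b - a)) ^ 2 := fun x => by ring
    simp_rw [this]
    rw [intervalIntegral.integral_add (hg2.sub (hg.const_mul _)) intervalIntegrable_const,
      intervalIntegral.integral_sub hg2 (hg.const_mul _), intervalIntegral.integral_const_mul,
      intervalIntegral.integral_const, smul_eq_mul]
  rw [h1] at h0
  have h2 : 2 * (I / (b - a)) * I = 2 * (I ^ 2 / (b - a)) := by ring
  have h3 : (b - a) * (I / (b - a)) ^ 2 = I ^ 2 / (b - a) := by field_simp
  rw [h2, h3] at h0
  rw [← div_le_iff₀' hba]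
  linarith

/-- Take `G` to be the running integral of the squared derivative and apply Cauchy-Schwarz; it
dominates every sum of chord energies. -/
theorem exists_energy_of_mem_smoothClass_two {f : unitInterval → ℝ} (hf : f ∈ smoothClass 2) :
    ∃ G : unitInterval → ℝ, Monotone G ∧ G 1 - G 0 ≤ 1 ∧
      ∀ u v : unitInterval, u ≤ v → (f v - f u) ^ 2 ≤ ((v : ℝ) - u) * (G v - G u) := by
  obtain ⟨hac, hnorm⟩ := hf
  set F := Set.IccExtend (zero_le_one' ℝ) f
  have hmem : MemLp (deriv F) 2 (volume.restrict (Set.Icc (0 : ℝ) 1)) :=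
    ⟨(measurable_deriv F).aestronglyMeasurable, hnorm.trans_lt (by simp)⟩
  have hsq : IntegrableOn (fun x => deriv F x ^ 2) (Set.Icc 0 1) := hmem.integrable_sq
  have hint : ∀ a b : unitInterval, IntervalIntegrable (fun x => deriv F x ^ 2) volume a b :=
    fun a b => (hsq.mono_set (Set.uIcc_subset_Icc a.2 b.2)).intervalIntegrable
  have hint1 : ∀ a b : unitInterval, IntervalIntegrable (deriv F) volume a b := fun a b =>
    (IntegrableOn.mono_set (hmem.integrable one_le_two)
      (Set.uIcc_subset_Icc a.2 b.2)).intervalIntegrable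
  have hG : ∀ u v : unitInterval, (∫ x in (0 : ℝ)..v, deriv F x ^ 2) -
      (∫ x in (0 : ℝ)..u, deriv F x ^ 2) = ∫ x in (u : ℝ)..v, deriv F x ^ 2 := fun u v =>
    intervalIntegral.integral_interval_sub_left (hint 0 v) (hint 0 u)
  refine ⟨fun x => ∫ t in (0 : ℝ)..x, deriv F t ^ 2, fun u v huv => ?_, ?_, fun u v huv => ?_⟩
  · rw [← sub_nonneg, hG]
    exact intervalIntegral.integral_nonneg huv fun _ _ => sq_nonneg _
  · rw [hG]
    simp only [Set.Icc.coe_zero, Set.Icc.coe_one]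
    rw [intervalIntegral.integral_of_le zero_le_one, ← integral_Icc_eq_integral_Ioc]
    have h2 := hmem.eLpNorm_eq_integral_rpow_norm (by simp) (by simp)
    rw [h2] at hnorm
    have h3 := ENNReal.ofReal_le_one.1 hnorm
    simp only [ENNReal.toReal_ofNat, Real.rpow_ofNat, Real.norm_eq_abs, sq_abs] at h3
    by_contra! h4
    exact h3.not_gt (Real.one_lt_rpow h4 (by norm_num))
  · rw [hG]
    have hsub : AbsolutelyContinuousOnInterval F u v := by
      refine hac.mono ?_
      rw [Set.uIcc_of_le zero_le_one]
      exact Set.uIcc_subset_Icc u.2 v.2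
    have := sq_integral_le_mul_integral_sq huv (hint1 u v) (hint u v)
    rw [hsub.integral_deriv_eq_sub] at this
    simpa [F] using this

/-! ### The potential -/

/-- For `b ≤ a`, Bernoulli gives `(a+b)^s ≥ a^s + s * a^(s-1) * b`, and `a^(s-1) * b ≥ b^s`. -/
theorem rpow_min_le_add_rpow_sub {s a b : ℝ} (hs : 1 ≤ s) (ha : 0 ≤ a) (hb : 0 ≤ b) :
    (s - 1) * min a b ^ s ≤ (a + b) ^ s - a ^ s - b ^ s := by
  wlog hab : b ≤ a generalizing a b
  · have := this hb ha (le_of_not_ge hab)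
    rw [min_comm, add_comm]
    linarith
  rw [min_eq_right hab]
  rcases hb.eq_or_lt with rfl | hb0
  · simp [Real.zero_rpow (by linarith : s ≠ 0)]
  have ha0 : 0 < a := hb0.trans_le hab
  have h1 : 1 + s * (b / a) ≤ (1 + b / a) ^ s :=
    one_add_mul_self_le_rpow_one_add (by linarith [div_nonneg hb ha]) hs
  have h2 : (a + b) ^ s = a ^ s * (1 + b / a) ^ s := by
    rw [← Real.mul_rpow ha (by positivity)]
    congr 1
    field_simp
  have h3 : b ^ s ≤ a ^ s * (b / a) := by
    have e1 : b ^ s = b ^ (s - 1) * b := by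
      rw [← Real.rpow_add_one hb0.ne', sub_add_cancel]
    have e2 : a ^ s = a ^ (s - 1) * a := by
      rw [← Real.rpow_add_one ha0.ne', sub_add_cancel]
    rw [e1, e2, mul_assoc, mul_div_cancel₀ _ ha0.ne']
    exact mul_le_mul_of_nonneg_right (Real.rpow_le_rpow hb hab (by linarith)) hb
  have h4 : a ^ s * (1 + s * (b / a)) ≤ (a + b) ^ s := by
    rw [h2]
    exact mul_le_mul_of_nonneg_left h1 (by positivity)
  nlinarith

theorem abs_rpow_le_of_sq_le_mul {ε δ E w : ℝ} (hε : 0 < ε) (hε1 : ε < 1) (hE : 0 ≤ E)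
    (hw : 0 ≤ w) (h : δ ^ 2 ≤ E * w) :
    |δ| ^ (1 + ε) ≤ ε ^ (-(1 / 2) : ℝ) * E + ε ^ (1 / 2 : ℝ) * w ^ ((1 + ε) / (1 - ε)) := by
  have hX : 0 ≤ ε ^ (-(1 / 2) : ℝ) * E := by positivity
  have hY : 0 ≤ ε ^ (1 / 2 : ℝ) * w ^ ((1 + ε) / (1 - ε)) := by positivity
  have h1 : |δ| ^ (1 + ε) ≤ (E * w) ^ ((1 + ε) / 2) := by
    calc |δ| ^ (1 + ε) = (|δ| ^ (2 : ℝ)) ^ ((1 + ε) / 2) := by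
          rw [← Real.rpow_mul (abs_nonneg _)]; congr 1; ring
      _ = (δ ^ 2) ^ ((1 + ε) / 2) := by rw [Real.rpow_two, sq_abs]
      _ ≤ _ := Real.rpow_le_rpow (sq_nonneg _) h (by linarith)
  -- The powers of `ε` combine to `ε^(-ε/2) ≥ 1`, and the weights are at most `1`, so all of these
  -- can be dropped.
  have h2 := Real.geom_mean_le_arith_mean2_weighted (w₁ := (1 + ε) / 2) (w₂ := (1 - ε) / 2)
    (by linarith) (by linarith) hX hY (by ring)
  have h3 : (ε ^ (-(1 / 2) : ℝ) * E) ^ ((1 + ε) / 2) *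
      (ε ^ (1 / 2 : ℝ) * w ^ ((1 + ε) / (1 - ε))) ^ ((1 - ε) / 2) =
      ε ^ (-(ε / 2)) * (E * w) ^ ((1 + ε) / 2) := by
    rw [Real.mul_rpow (by positivity) hE, Real.mul_rpow (by positivity) (by positivity),
      Real.mul_rpow hE hw, ← Real.rpow_mul hε.le, ← Real.rpow_mul hε.le, ← Real.rpow_mul hw]
    have e1 : (1 + ε) / (1 - ε) * ((1 - ε) / 2) = (1 + ε) / 2 := by
      have : (1 - ε) ≠ 0 := by linarith
      field_simp
    have e2 : ε ^ (-(ε / 2)) =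
        ε ^ (-(1 / 2) * ((1 + ε) / 2)) * ε ^ (1 / 2 * ((1 - ε) / 2)) := by
      rw [← Real.rpow_add hε]; congr 1; ring
    rw [e1, e2]; ring
  have h4 : 1 ≤ ε ^ (-(ε / 2)) :=
    Real.one_le_rpow_of_pos_of_le_one_of_nonpos hε hε1.le (by linarith)
  have h5 : (E * w) ^ ((1 + ε) / 2) ≤ ε ^ (-(ε / 2)) * (E * w) ^ ((1 + ε) / 2) :=
    le_mul_of_one_le_left (by positivity) h4
  rw [h3] at h2
  nlinarith

/-- The gap potential: the energy of a chord, corrected by a concave function of its width. -/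
def chordPotential (ε : ℝ) (f : unitInterval → ℝ) (u v : unitInterval) : ℝ :=
  ε ^ (-(1 / 2) : ℝ) * ((f v - f u) ^ 2 / (v - u)) -
    ε ^ (1 / 2 : ℝ) * ((1 - ε) / (2 * ε)) *
      (((v : ℝ) - u) ^ ((1 + ε) / (1 - ε)) - (1 + ε) / (1 - ε) * (v - u))

/-- This handles inputs outside the known range. The linear width term, which is additive and so
neutral under splitting, serves here: as `d ≤ 1` gives `d^s ≤ d`, it pays for `d^s`. -/
theorem abs_sub_rpow_le_chordPotential {ε : ℝ} (hε : 0 < ε) (hε1 : ε < 1)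
    (f : unitInterval → ℝ) {u v : unitInterval} (huv : u ≤ v) :
    |f v - f u| ^ (1 + ε) ≤ chordPotential ε f u v := by
  have hε' : 0 < 1 - ε := by linarith
  set s := (1 + ε) / (1 - ε) with hs
  have hs1 : 1 ≤ s := by rw [hs, le_div_iff₀ hε']; linarith
  have hs2 : (1 - ε) / (2 * ε) * (s - 1) = 1 := by rw [hs]; field_simp; ring
  unfold chordPotential
  rw [← hs]
  rcases huv.eq_or_lt with rfl | hlt
  · simp [Real.zero_rpow (by linarith : 1 + ε ≠ 0), Real.zero_rpow (by linarith : s ≠ 0)]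
  have hd : (0 : ℝ) < v - u := sub_pos.2 hlt
  have hd1 : (v : ℝ) - u ≤ 1 := by linarith [v.2.2, u.2.1]
  have h1 := abs_rpow_le_of_sq_le_mul (δ := f v - f u) (E := (f v - f u) ^ 2 / (v - u)) hε hε1
    (by positivity) hd.le (by rw [div_mul_cancel₀ _ hd.ne'])
  rw [← hs] at h1
  have h2 : ((v : ℝ) - u) ^ s ≤ v - u := by
    simpa using Real.rpow_le_rpow_of_exponent_ge hd hd1 hs1
  set d := (v : ℝ) - u
  have h3 : d ^ s ≤ (1 - ε) / (2 * ε) * (s * d - d ^ s) := by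
    calc d ^ s = (1 - ε) / (2 * ε) * (s * d ^ s - d ^ s) := by
          linear_combination (-d ^ s) * hs2
      _ ≤ _ := by gcongr
  have h4 := mul_le_mul_of_nonneg_left h3 (by positivity : 0 ≤ ε ^ (1 / 2 : ℝ))
  linarith

theorem isGapPotential_chordPotential {ε : ℝ} (hε : 0 < ε) (hε1 : ε < 1)
    (f : unitInterval → ℝ) : IsGapPotential (1 + ε) f (chordPotential ε f) where
  right u x h := by rw [abs_sub_comm]; exact abs_sub_rpow_le_chordPotential hε hε1 f h
  left x v h := abs_sub_rpow_le_chordPotential hε hε1 f h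
  inner u x v hux hxv := by
    have hε' : 0 < 1 - ε := by linarith
    have ha : (0 : ℝ) < x - u := sub_pos.2 hux
    rcases hxv.eq_or_lt with rfl | hlt
    -- A repeated input: interpolation is exact, and the new zero-width gap has nonnegative
    -- potential.
    · have := abs_sub_rpow_le_chordPotential hε hε1 f (le_refl x)
      rw [sub_self, abs_zero, Real.zero_rpow (by linarith)] at this
      rw [div_self ha.ne', mul_one, add_sub_cancel, sub_self, abs_zero,
        Real.zero_rpow (by linarith)]
      linarith
    have hb : (0 : ℝ) < v - x := sub_pos.2 hlt
    have hab : (v : ℝ) - u = (x - u) + (v - x) := by ring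
    unfold chordPotential
    rw [hab]
    set s := (1 + ε) / (1 - ε) with hs
    have hs1 : 1 ≤ s := by rw [hs, le_div_iff₀ hε']; linarith
    -- The coefficient in the potential is `1/(s-1)`, cancelling the factor from
    -- `rpow_min_le_add_rpow_sub`.
    have hs2 : (1 - ε) / (2 * ε) * (s - 1) = 1 := by rw [hs]; field_simp; ring
    set a := (x : ℝ) - u
    set b := (v : ℝ) - x
    set δ := f u + (f v - f u) * (a / (a + b)) - f x with hδ
    have hE : (f x - f u) ^ 2 / a + (f v - f x) ^ 2 / b - (f v - f u) ^ 2 / (a + b) =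
        δ ^ 2 * ((a + b) / (a * b)) := by
      rw [hδ]; field_simp; ring
    have hmin : 1 ≤ (a + b) / (a * b) * min a b := by
      rw [div_mul_eq_mul_div, one_le_div (by positivity)]
      rcases le_total a b with h | h
      · rw [min_eq_left h]; nlinarith
      · rw [min_eq_right h]; nlinarith
    have h1 := abs_rpow_le_of_sq_le_mul (δ := δ) (E := δ ^ 2 * ((a + b) / (a * b)))
      (w := min a b) hε hε1 (by positivity) (by positivity) (by
        rw [mul_assoc]; exact le_mul_of_one_le_right (sq_nonneg _) hmin)
    rw [← hE, ← hs] at h1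
    have h2 := mul_le_mul_of_nonneg_left (rpow_min_le_add_rpow_sub hs1 ha.le hb.le)
      (by positivity : 0 ≤ (1 - ε) / (2 * ε))
    rw [← mul_assoc, hs2, one_mul] at h2
    have h3 := mul_le_mul_of_nonneg_left h2 (by positivity : 0 ≤ ε ^ (1 / 2 : ℝ))
    linarith

theorem upper_bound_two {ε : ℝ} (hε : 0 < ε) (hε1 : ε < 1) :
    opt (1 + ε) (smoothClass 2) ≤ ENNReal.ofReal (2 * ε ^ (-(1 / 2) : ℝ)) := by
  refine (iInf_le _ linearInterpolation).trans (IsGapPotential.worstLoss_le fun f hf => ?_)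
  obtain ⟨G, hG, hG1, hfG⟩ := exists_energy_of_mem_smoothClass_two hf
  have hε' : 0 < 1 - ε := by linarith
  have hlam : 0 < ε ^ (-(1 / 2) : ℝ) := by positivity
  have hlam' : ε ^ (1 / 2 : ℝ) = ε ^ (-(1 / 2) : ℝ) * ε := by
    rw [← Real.rpow_add_one hε.ne']; norm_num
  have hκ : 0 ≤ ε ^ (1 / 2 : ℝ) * ((1 - ε) / (2 * ε)) := by positivity
  -- Dropping the negative power term leaves energy plus a multiple of width, both increments of a
  -- monotone function.
  refine ⟨chordPotential ε f, fun x => ε ^ (-(1 / 2) : ℝ) * G x +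
    ε ^ (1 / 2 : ℝ) * ((1 - ε) / (2 * ε)) * ((1 + ε) / (1 - ε) * x),
    isGapPotential_chordPotential hε hε1 f, fun u v huv => ?_, fun u v huv => ?_, ?_⟩
  · have h1 := hG huv
    have h2 : (u : ℝ) ≤ v := huv
    dsimp only
    gcongr
  · have hd : (0 : ℝ) ≤ v - u := sub_nonneg.2 huv
    have h1 : (f v - f u) ^ 2 / ((v : ℝ) - u) ≤ G v - G u :=
      div_le_of_le_mul₀ hd (sub_nonneg.2 (hG huv)) (by rw [mul_comm]; exact hfG u v huv)
    have h2 := mul_le_mul_of_nonneg_left h1 hlam.le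
    have h3 := mul_nonneg hκ (Real.rpow_nonneg hd ((1 + ε) / (1 - ε)))
    unfold chordPotential
    linarith
  · have h1 := mul_le_mul_of_nonneg_left hG1 hlam.le
    have h2 : ε ^ (1 / 2 : ℝ) * ((1 - ε) / (2 * ε)) * ((1 + ε) / (1 - ε)) ≤
        ε ^ (-(1 / 2) : ℝ) := by
      rw [hlam']
      calc _ = ε ^ (-(1 / 2) : ℝ) * ((1 + ε) / 2) := by field_simp
        _ ≤ _ := mul_le_of_le_one_right hlam.le (by linarith)
    simp only [Set.Icc.coe_zero, Set.Icc.coe_one]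
    linarith

end OnlineLearning

end

theorem theorem1 :
    ∃ c C : ℝ, 0 < c ∧ 0 < C ∧ ∀ ε : ℝ, 0 < ε → ε < 1 →
      (ENNReal.ofReal (c * ε ^ (-(1 / 2) : ℝ)) ≤
          OnlineLearning.opt (1 + ε) (OnlineLearning.smoothClass ⊤) ∧
        OnlineLearning.opt (1 + ε) (OnlineLearning.smoothClass ⊤) ≤
          ENNReal.ofReal (C * ε ^ (-(1 / 2) : ℝ))) ∧
      ∀ q : ℝ, 2 ≤ q →
        ENNReal.ofReal (c * ε ^ (-(1 / 2) : ℝ)) ≤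
          OnlineLearning.opt (1 + ε) (OnlineLearning.smoothClass (ENNReal.ofReal q)) ∧
        OnlineLearning.opt (1 + ε) (OnlineLearning.smoothClass (ENNReal.ofReal q)) ≤
          ENNReal.ofReal (C * ε ^ (-(1 / 2) : ℝ)) := by
  open OnlineLearning in
  refine ⟨1 / 512, 2, by norm_num, by norm_num, fun ε hε hε1 =>
    ⟨⟨lower_bound_lipschitz hε hε1,
      (opt_mono _ (smoothClass_anti le_top)).trans (upper_bound_two hε hε1)⟩, fun q hq =>
    ⟨(lower_bound_lipschitz hε hε1).trans (opt_mono _ (smoothClass_anti le_top)),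
      (opt_mono _ (smoothClass_anti ?_)).trans (upper_bound_two hε hε1)⟩⟩⟩
  rw [← ENNReal.ofReal_ofNat]
  exact ENNReal.ofReal_le_ofReal hq
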